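/- **Theorem 1 (Order conditions for LIRK-W methods of type 1).** A type 1 LIRK-W method with $s$ stages is given by real coefficients $a_{i,j}$ (with $a_{i,j}=0$ for $j\ge i$), $\gamma_{i,j}$ (with $\gamma_{i,j}=0$ for $j>i$), $b_i$ and $g_i$. Applied to $y'=F(y)$, $y(t)\in\mathbb{R}^N$, with a time-dependent linear term $\widetilde{\mathbf L}(t)\in\mathbb{R}^{N\times N}$, one step of size $h$ from $(t_n,y_n)$ reads $$Y_i = y_n + h\sum_{j=1}^{i-1} a_{i,j}F(Y_j) + h\sum_{j=1}^{i}\gamma_{i,j}\mathbf L_jY_j,\quad i=1,\dots,s,\qquad y_{n+1} = y_n + h\sum_{i=1}^s b_iF(Y_i) + h\sum_{i=1}^s g_i\mathbf L_iY_i,$$ with $\mathbf L_j=\widetilde{\mathbf L}(t_n+h\gamma_{j,j})$. The method has order $p$ if for every $N$, every $C^\infty$ function $F:\mathbb{R}^N\to\mathbb{R}^N$, every $C^\infty$ function $\widetilde{\mathbf L}:\mathbb{R}\to\mathbb{R}^{N\times N}$ (not related to $F$), and every solution $y$ of $y'=F(y)$ on an interval $[t_n,t_F]$ with $t_n<t_F$,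 the step from $y_n=y(t_n)$ is defined for all small $h>0$ and satisfies $\|y(t_n+h)-y_{n+1}\|=O(h^{p+1})$ as $h\to0^+$. The set $LW_1$ consists of the rooted trees with meagre, fat and square vertices in which every fat vertex has at most one child and every square vertex has exactly one child, which is square or fat. Write $[\tau_1,\dots,\tau_m]_\bullet$ ($m\ge0$) for the tree with a meagre root and subtrees $\tau_1,\dots,\tau_m$. For $q\ge0$ write $[\tau_1]_{\theta_q}$ for the tree obtained by attaching $\tau_1$ to a fat vertex and prepending $q$ square vertices below it, and $[\;]_{\theta_q}$ for the same with nothing attached to the fat vertex (for $q=0$ these are $[\tau_1]_\circ$ and $[\;]_\circ$). Let $T\subset LW_1$ be the ordinary Butcher trees, i.e. those with only meagre vertices. Let $\rho(\tau)$ be the number of vertices of $\tau$ (of all three kinds), and for $\tau=[\tau_1,\dots,\tau_m]_\bullet\in T$ let $\gamma(\tau)=\rho(\tau)\,\gamma(\tau_1)\cdots\gamma(\tau_m)$. Define recursively, for $j=1,\dots,s$, $$\Phi^1_j(\tau)=\begin{cases} b_j\,\bar\Phi^1_j(\tau_1)\cdots\bar\Phi^1_j(\tau_m), & \tau=[\tau_1,\dots,\tau_m]_\bullet,\\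 g_j\,\gamma_{j,j}^{q}\,\bar\Phi^1_j(\tau_1), & \tau=[\tau_1]_{\theta_q},\\ g_j\,\gamma_{j,j}^{q}, & \tau=[\;]_{\theta_q},\end{cases} \qquad \bar\Phi^1_j(\tau)=\begin{cases} \sum_k a_{j,k}\,\bar\Phi^1_k(\tau_1)\cdots\bar\Phi^1_k(\tau_m), & \tau=[\tau_1,\dots,\tau_m]_\bullet,\\ \sum_k\gamma_{j,k}\,\gamma_{k,k}^{q}\,\bar\Phi^1_k(\tau_1), & \tau=[\tau_1]_{\theta_q},\\ \sum_k\gamma_{j,k}\,\gamma_{k,k}^{q}, & \tau=[\;]_{\theta_q},\end{cases}$$ where empty products and $\gamma_{k,k}^0$ are $1$. Then the method has order $p$ if and only if $$\sum_j\Phi^1_j(\tau)=\frac1{\gamma(\tau)}\quad\text{for all }\tau\in T\text{ with }\rho(\tau)\le p,$$ $$\sum_j\Phi^1_j(\tau)=0\quad\text{for all }\tau\in LW_1\setminus T\text{ with }\rho(\tau)\le p.$$ -/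

import Mathlib

open scoped ContDiff Topology

namespace LIRKW

/-- `LW₁`-trees: trees with meagre, fat and square vertices in which a fat vertex has at most one
child and a square vertex has exactly one child, whose root is square or fat. Since a chain of
square vertices has to end in a fat vertex, these are generated by the three operations below.
The children of a meagre vertex are listed in some order; no notion defined on trees here depends
on that order, so that a property of all these trees is a property of all unordered trees. -/
inductive LWTree : Type
  /-- `[τ₁, …, τₘ]_•`: a meagre root with subtrees `τ₁, …, τₘ` (for `m = 0` the single vertex). -/
  | meagre (m : ℕ) (τ : Fin m → LWTree) : LWTree
  /-- `[ ]_{θ_p}`: a fat leaf below which `p` square vertices are prepended; for `p = 0` it is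
  `[ ]_∘`. -/
  | fatLeaf (p : ℕ) : LWTree
  /-- `[τ]_{θ_p}`: the tree `τ` attached to a fat vertex to which `p` square vertices are
  prepended; for `p = 0` it is `[τ]_∘`. -/
  | fat (p : ℕ) (τ : LWTree) : LWTree

namespace LWTree

/-- `ρ(τ)`, the number of vertices (meagre, fat and square). -/
def order : LWTree → ℕ
  | meagre _ τ => 1 + ∑ i, (τ i).order
  | fatLeaf p => p + 1
  | fat p τ => p + 1 + τ.order

/-- `γ(τ)`: the product of `ρ(τ)` and the orders of all trees which appear when the roots, one
after another, are removed. -/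
def density : LWTree → ℕ
  | meagre m τ => (meagre m τ).order * ∏ i, (τ i).density
  | fatLeaf p => (p + 1).factorial
  | fat p τ => (∏ r ∈ Finset.range (p + 1), (r + 1 + τ.order)) * τ.density

/-- `τ ∈ T`: the tree is an ordinary Butcher tree, i.e. all its vertices are meagre. -/
def IsButcher : LWTree → Prop
  | meagre _ τ => ∀ i, (τ i).IsButcher
  | fatLeaf _ => False
  | fat _ _ => False

end LWTree

/-- The coefficients of a LIRK-W method with `s` stages: `a` is strictly lower triangular and
`γ` is lower triangular. -/
structure Method (s : ℕ) where
  a : Fin s → Fin s → ℝ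
  γ : Fin s → Fin s → ℝ
  b : Fin s → ℝ
  g : Fin s → ℝ
  a_eq_zero : ∀ i j, i ≤ j → a i j = 0
  γ_eq_zero : ∀ i j, i < j → γ i j = 0

namespace Method

variable {s : ℕ}

/-- The inner weights `Φ̄¹_j(τ)`, with the summation over the stage index `k` carried out. -/
noncomputable def phiBar (M : Method s) : LWTree → Fin s → ℝ
  | .meagre _ τ, j => ∑ k, M.a j k * ∏ i, M.phiBar (τ i) k
  | .fatLeaf p, j => ∑ k, M.γ j k * M.γ k k ^ p
  | .fat p τ, j => ∑ k, M.γ j k * M.γ k k ^ p * M.phiBar τ k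

/-- The weights `Φ¹_j(τ)`. -/
noncomputable def phi (M : Method s) : LWTree → Fin s → ℝ
  | .meagre _ τ, j => M.b j * ∏ i, M.phiBar (τ i) j
  | .fatLeaf p, j => M.g j * M.γ j j ^ p
  | .fat p τ, j => M.g j * M.γ j j ^ p * M.phiBar τ j

/-- `Y` is a solution of the stage equations of the type 1 method for a step of size `h` from
`(tₙ, yₙ)`, applied to `y' = F(y)` with the time dependent linear term `L`:
`Y_i = yₙ + h ∑_{j < i} a_{ij} F(Y_j) + h ∑_{j ≤ i} γ_{ij} L_j Y_j`, `L_j = L(tₙ + h γ_{jj})`.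
(The sums may run over all `j` because `a` and `γ` are triangular.) -/
def IsStages (M : Method s) {N : ℕ} (F : (Fin N → ℝ) → (Fin N → ℝ))
    (L : ℝ → ((Fin N → ℝ) →L[ℝ] (Fin N → ℝ))) (tn : ℝ) (yn : Fin N → ℝ) (h : ℝ)
    (Y : Fin s → (Fin N → ℝ)) : Prop :=
  ∀ i, Y i = yn + h • ∑ j, M.a i j • F (Y j)
    + h • ∑ j, M.γ i j • L (tn + h * M.γ j j) (Y j)

/-- The output of the step:
`yₙ₊₁ = yₙ + h ∑_i b_i F(Y_i) + h ∑_i g_i L_i Y_i`, `L_i = L(tₙ + h γ_{ii})`. -/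
noncomputable def output (M : Method s) {N : ℕ} (F : (Fin N → ℝ) → (Fin N → ℝ))
    (L : ℝ → ((Fin N → ℝ) →L[ℝ] (Fin N → ℝ))) (tn : ℝ) (yn : Fin N → ℝ) (h : ℝ)
    (Y : Fin s → (Fin N → ℝ)) : Fin N → ℝ :=
  yn + h • ∑ i, M.b i • F (Y i) + h • ∑ i, M.g i • L (tn + h * M.γ i i) (Y i)

/-- The type 1 method has order `p` (at least): for every smooth right-hand side `F` on `ℝᴺ`,
every smooth time dependent linear term `L` (with no relation to `F`), and every solution `y` of
`y' = F(y)` on an interval `[tₙ, t_F]`, the step of size `h` from `(tₙ, y(tₙ))` is defined for all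
small `h > 0` and its error is `O(h^(p+1))`. -/
def HasOrder (M : Method s) (p : ℕ) : Prop :=
  ∀ (N : ℕ) (F : (Fin N → ℝ) → (Fin N → ℝ)) (L : ℝ → ((Fin N → ℝ) →L[ℝ] (Fin N → ℝ)))
    (tn tF : ℝ) (y : ℝ → (Fin N → ℝ)),
    ContDiff ℝ ∞ F → ContDiff ℝ ∞ L → tn < tF →
    (∀ t ∈ Set.Icc tn tF, HasDerivWithinAt y (F (y t)) (Set.Icc tn tF) t) →
    ∃ C : ℝ, ∀ᶠ h in 𝓝[>] (0 : ℝ),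
      (∃ Y, M.IsStages F L tn (y tn) h Y) ∧
      ∀ Y, M.IsStages F L tn (y tn) h Y →
        ‖y (tn + h) - M.output F L tn (y tn) h Y‖ ≤ C * h ^ (p + 1)

end Method

end LIRKW

open scoped ContDiff Topology

/-! Everything is expanded in tree series, sums of `h ^ ρ(τ) * c τ` times the elementary
differential of `τ`. Trees are ordered, so multiplying out the Taylor terms of `F` produces each
tree once and no symmetry factors occur. If `c` gives the coefficients of `y`, then `h F(y)` and `h
L(tₙ + h γ) y` have the coefficients `fieldWeight c` and `linearWeight γ c`. The exact solution
therefore has coefficients `exactWeight` (`order_mul_exactWeight`), the stages `phiBar`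
(`phiBar_eq`) and the output `∑ j, phi` (`phi_eq`).

Sufficiency: if the coefficients agree up to order `p`, the two expansions differ by `O(h ^ (p +
1))`. The expansions themselves are bootstrapped, since each passage through the equation gains a
factor `h` (`isBigO_solution_sub`, `isBigO_stages_sub`).

Necessity: for a finite subtree-closed set of trees there is a polynomial problem with one
coordinate per tree, plus a constant coordinate 1, on which these series are exact and the
coordinate of `τ` is just `h ^ ρ(τ) * c τ`. An error `O(h ^ (p + 1))` then forces equal coefficients
for `ρ(τ) ≤ p`. -/

namespace LIRKW

/-! ### Taylor expansion with remainder -/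

section Taylor

open Asymptotics Filter

variable {E G : Type*} [NormedAddCommGroup E] [NormedSpace ℝ E]
  [NormedAddCommGroup G] [NormedSpace ℝ G]

theorem iteratedDeriv_comp_line {f : E → G} (hf : ContDiff ℝ ∞ f) (x v : E) (k : ℕ) :
    iteratedDeriv k (fun t : ℝ => f (x + t • v)) =
      fun t => iteratedFDeriv ℝ k f (x + t • v) (fun _ => v) := by
  induction k with
  | zero => ext t; simp
  | succ k ih =>
    ext t
    rw [iteratedDeriv_succ, ih, iteratedFDeriv_succ_apply_left]
    have h1 : HasFDerivAt (iteratedFDeriv ℝ k f) (fderiv ℝ (iteratedFDeriv ℝ k f) (x + t • v))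
        (x + t • v) :=
      ((hf.differentiable_iteratedFDeriv (by exact_mod_cast ENat.natCast_lt_top k)) _).hasFDerivAt
    have h2 : HasDerivAt (fun t : ℝ => x + t • v) v t := by
      simpa using ((hasDerivAt_id t).smul_const v).const_add x
    have h3 := h1.comp_hasDerivAt t h2
    have h4 := (ContinuousMultilinearMap.apply ℝ (fun _ : Fin k => E) G
      (fun _ => v)).hasFDerivAt.comp_hasDerivAt t h3
    exact h4.deriv

/-- Taylor's formula for smooth functions of several variables. -/
theorem taylor_isBigO {f : E → G} (hf : ContDiff ℝ ∞ f) (x : E) (n : ℕ) :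
    (fun v => f (x + v) - ∑ m ∈ Finset.range (n + 1),
      ((m.factorial : ℝ)⁻¹ • iteratedFDeriv ℝ m f x) (fun _ => v)) =O[𝓝 0]
      fun v => ‖v‖ ^ (n + 1) := by
  have hc : ContinuousAt (iteratedFDeriv ℝ (n + 1) f) x :=
    (hf.continuous_iteratedFDeriv (by exact_mod_cast le_top)).continuousAt
  obtain ⟨r, hr, hball⟩ := Metric.eventually_nhds_iff_ball.1
    (hc.norm.eventually (ge_mem_nhds (lt_add_one ‖iteratedFDeriv ℝ (n + 1) f x‖)))
  set C := ‖iteratedFDeriv ℝ (n + 1) f x‖ + 1 with hC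
  refine IsBigO.of_bound (C / n.factorial) ?_
  filter_upwards [Metric.ball_mem_nhds (0 : E) hr] with v hv
  have hg : ContDiff ℝ ∞ (fun t : ℝ => f (x + t • v)) := by fun_prop
  have hgn : ∀ k : ℕ, ContDiff ℝ k (fun t : ℝ => f (x + t • v)) := fun k =>
    hg.of_le (by exact_mod_cast le_top)
  have hw : ∀ k : ℕ, ∀ t ∈ Set.Icc (0 : ℝ) 1,
      iteratedDerivWithin k (fun t : ℝ => f (x + t • v)) (Set.Icc 0 1) t =
        iteratedFDeriv ℝ k f (x + t • v) (fun _ => v) := by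
    intro k t ht
    rw [iteratedDerivWithin_eq_iteratedDeriv (uniqueDiffOn_Icc zero_lt_one)
      (hgn k).contDiffAt ht, iteratedDeriv_comp_line hf]
  -- One-variable Taylor along the segment from `x` to `x + v`, which stays in the ball where the
  -- derivative of order `n + 1` is bounded by `C`.
  have key := taylor_mean_remainder_bound (f := fun t : ℝ => f (x + t • v)) (a := 0) (b := 1)
    (C := C * ‖v‖ ^ (n + 1)) (x := 1) (n := n) zero_le_one
    (by exact_mod_cast (hgn (n + 1)).contDiffOn) (by simp) (by
      intro t ht
      rw [hw _ t ht]
      refine (ContinuousMultilinearMap.le_opNorm _ _).trans ?_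
      simp only [Finset.prod_const, Finset.card_univ, Fintype.card_fin]
      gcongr
      apply hball
      rw [Metric.mem_ball, dist_eq_norm, add_sub_cancel_left, norm_smul]
      rw [Metric.mem_ball, dist_zero_right] at hv
      refine lt_of_le_of_lt ?_ hv
      rw [Real.norm_eq_abs, abs_of_nonneg ht.1]
      exact mul_le_of_le_one_left (norm_nonneg _) ht.2)
  rw [taylor_within_apply] at key
  have h0 : ∀ m : ℕ, iteratedDerivWithin m (fun t : ℝ => f (x + t • v)) (Set.Icc 0 1) 0 =
      iteratedFDeriv ℝ m f x (fun _ => v) := fun m => by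
    rw [hw m 0 (by simp)]; simp
  simp only [h0, sub_zero, one_pow, mul_one, one_smul] at key
  simp only [smul_apply, norm_pow, norm_norm]
  calc _ ≤ _ := key
    _ = _ := by ring

theorem taylor_isBigO_real {f : ℝ → G} (hf : ContDiff ℝ ∞ f) (x : ℝ) (n : ℕ) :
    (fun v => f (x + v) - ∑ m ∈ Finset.range (n + 1),
      v ^ m • ((m.factorial : ℝ)⁻¹ • iteratedDeriv m f x)) =O[𝓝 0]
      fun v => v ^ (n + 1) := by
  have h := taylor_isBigO hf x n
  simp only [smul_apply,
    iteratedFDeriv_apply_eq_iteratedDeriv_mul_prod, Finset.prod_const, Finset.card_univ,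
    Fintype.card_fin] at h
  simp only [smul_comm _ (Nat.cast (R := ℝ) _)⁻¹] at h ⊢
  exact h.trans (IsBigO.of_bound 1 (by simp))

end Taylor

/-! ### Coefficient calculus on trees -/

namespace LWTree

theorem order_pos : ∀ τ : LWTree, 0 < τ.order
  | meagre _ _ => by rw [order]; omega
  | fatLeaf _ => by rw [order]; omega
  | fat _ _ => by rw [order]; omega

/-- A set of trees which contains the subtrees of its members. -/
structure SubtreeClosed (S : Finset LWTree) : Prop where
  meagre : ∀ m τ, LWTree.meagre m τ ∈ S → ∀ i, τ i ∈ S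
  fat : ∀ q τ, LWTree.fat q τ ∈ S → τ ∈ S

theorem exists_subtreeClosed (t : LWTree) : ∃ S : Finset LWTree, t ∈ S ∧ SubtreeClosed S := by
  classical
  induction t with
  | meagre m τ ih =>
    choose S hS hc using ih
    refine ⟨insert (meagre m τ) (Finset.univ.biUnion S), by simp, ⟨?_, ?_⟩⟩
    · intro m' τ' h i
      simp only [Finset.mem_insert, Finset.mem_biUnion, Finset.mem_univ, true_and] at h ⊢
      rcases h with h | ⟨j, h⟩
      · cases h
        exact Or.inr ⟨i, hS i⟩
      · exact Or.inr ⟨j, (hc j).meagre _ _ h i⟩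
    · intro q' τ' h
      simp only [Finset.mem_insert, Finset.mem_biUnion, Finset.mem_univ, true_and] at h ⊢
      rcases h with h | ⟨j, h⟩
      · cases h
      · exact Or.inr ⟨j, (hc j).fat _ _ h⟩
  | fatLeaf q => exact ⟨{fatLeaf q}, by simp, ⟨by simp, by simp⟩⟩
  | fat q τ ih =>
    obtain ⟨S, hS, hc⟩ := ih
    refine ⟨insert (LWTree.fat q τ) S, by simp, ⟨?_, ?_⟩⟩
    · intro m' τ' h i
      simp only [Finset.mem_insert, reduceCtorEq, false_or] at h ⊢
      exact Or.inr (hc.meagre _ _ h i)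
    · intro q' τ' h
      simp only [Finset.mem_insert] at h ⊢
      rcases h with h | h
      · cases h
        exact Or.inr hS
      · exact Or.inr (hc.fat _ _ h)

open Classical in
/-- The coefficient of `τ` in the expansion of the exact solution. -/
noncomputable def exactWeight (τ : LWTree) : ℝ := if τ.IsButcher then 1 / (τ.density : ℝ) else 0

/-- The coefficient of `τ` in the expansion of `h F(y)`, where `c` gives that of `y`. -/
def fieldWeight (c : LWTree → ℝ) : LWTree → ℝ
  | meagre _ τ => ∏ i, c (τ i)
  | _ => 0

/-- The coefficient of `τ` in the expansion of `h L(tₙ + h γ) y`, where `c` gives that of `y`. -/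
def linearWeight (γ : ℝ) (c : LWTree → ℝ) : LWTree → ℝ
  | meagre _ _ => 0
  | fatLeaf q => γ ^ q
  | fat q τ => γ ^ q * c τ

theorem exactWeight_of_isButcher {τ : LWTree} (h : τ.IsButcher) :
    exactWeight τ = 1 / (τ.density : ℝ) := if_pos h

theorem exactWeight_of_not_isButcher {τ : LWTree} (h : ¬ τ.IsButcher) : exactWeight τ = 0 :=
  if_neg h

/-- The equation `y' = F(y)` read coefficientwise: differentiating `h ^ ρ(τ)` brings down `ρ(τ)`,
which cancels the leading factor of the density. -/
theorem order_mul_exactWeight (τ : LWTree) :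
    τ.order * exactWeight τ = fieldWeight exactWeight τ := by
  cases τ with
  | meagre m τ =>
    have h0 : ((meagre m τ).order : ℝ) ≠ 0 := by exact_mod_cast (order_pos _).ne'
    by_cases hb : ∀ i, (τ i).IsButcher
    · have hτ : (meagre m τ).IsButcher := by rwa [IsButcher]
      simp only [fieldWeight, exactWeight_of_isButcher hτ, exactWeight_of_isButcher (hb _)]
      rw [Finset.prod_div_distrib, Finset.prod_const_one, density]
      push_cast
      field_simp
    · have hτ : ¬ (meagre m τ).IsButcher := by rwa [IsButcher]
      rw [exactWeight_of_not_isButcher hτ, mul_zero]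
      obtain ⟨i, hi⟩ := not_forall.1 hb
      exact (Finset.prod_eq_zero (Finset.mem_univ i) (exactWeight_of_not_isButcher hi)).symm
  | fatLeaf q => rw [exactWeight_of_not_isButcher (by simp [IsButcher]), mul_zero, fieldWeight]; simp
  | fat q τ => rw [exactWeight_of_not_isButcher (by simp [IsButcher]), mul_zero, fieldWeight]; simp

theorem mul_fieldWeight_pow (h : ℝ) (c : LWTree → ℝ) (τ : LWTree) :
    h * fieldWeight (fun τ => h ^ τ.order * c τ) τ = h ^ τ.order * fieldWeight c τ := by
  cases τ with
  | meagre m τ =>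
    simp only [fieldWeight, order, Finset.prod_mul_distrib, Finset.prod_pow_eq_pow_sum, pow_add]
    ring
  | fatLeaf q => simp [fieldWeight]
  | fat q τ => simp [fieldWeight]

/-- Each square vertex takes its power of `h` from the time argument `h * γ`; the fat vertex takes
the outer factor `h`. -/
theorem mul_linearWeight_pow (h γ : ℝ) (c : LWTree → ℝ) (τ : LWTree) :
    h * linearWeight (h * γ) (fun τ => h ^ τ.order * c τ) τ =
      h ^ τ.order * linearWeight γ c τ := by
  cases τ with
  | meagre m τ => simp [linearWeight]
  | fatLeaf q => simp only [linearWeight, order]; ring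
  | fat q τ => simp only [linearWeight, order]; ring

end LWTree

namespace Method

variable {s : ℕ} (M : Method s)

open LWTree

/-- The stage equation in coefficients; the kind of the root decides which of the two sums vanishes.
-/
theorem phiBar_eq (τ : LWTree) (j : Fin s) :
    M.phiBar τ j = ∑ k, M.a j k * fieldWeight (fun τ => M.phiBar τ k) τ +
      ∑ k, M.γ j k * linearWeight (M.γ k k) (fun τ => M.phiBar τ k) τ := by
  cases τ <;> simp [phiBar, fieldWeight, linearWeight, mul_assoc]

theorem phi_eq (τ : LWTree) (j : Fin s) :
    M.phi τ j = M.b j * fieldWeight (fun τ => M.phiBar τ j) τ +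
      M.g j * linearWeight (M.γ j j) (fun τ => M.phiBar τ j) τ := by
  cases τ <;> simp [phi, fieldWeight, linearWeight, mul_assoc]

theorem order_conditions_iff (p : ℕ) :
    ((∀ τ : LWTree, τ.IsButcher → τ.order ≤ p → ∑ j, M.phi τ j = 1 / (τ.density : ℝ)) ∧
      (∀ τ : LWTree, ¬ τ.IsButcher → τ.order ≤ p → ∑ j, M.phi τ j = 0)) ↔
    ∀ τ : LWTree, τ.order ≤ p → ∑ j, M.phi τ j = exactWeight τ := by
  constructor
  · rintro ⟨h1, h2⟩ τ hτ
    by_cases hb : τ.IsButcher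
    · rw [h1 τ hb hτ, exactWeight, if_pos hb]
    · rw [h2 τ hb hτ, exactWeight, if_neg hb]
  · intro h
    exact ⟨fun τ hb hτ => by rw [h τ hτ, exactWeight, if_pos hb],
      fun τ hb hτ => by rw [h τ hτ, exactWeight, if_neg hb]⟩

end Method

open LWTree Asymptotics Filter

/-! ### Test problems and necessity -/

section TestProblem

variable (S : Finset LWTree)

/-- The dimension of the test problem for `S`: a coordinate for each tree in `S`, and one more. -/
abbrev testDim : ℕ := Fintype.card (Option S)

/-- The position of a coordinate of the test problem. -/
noncomputable abbrev testIndex : Option S ≃ Fin (testDim S) := Fintype.equivFin _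

/-- The vector with the coordinate `f τ` for `τ ∈ S` and the additional coordinate `c`. -/
noncomputable def testVec (c : ℝ) (f : LWTree → ℝ) : Fin (testDim S) → ℝ := fun i =>
  ((testIndex S).symm i).elim c fun τ => f τ

open Classical in
/-- The coordinate of a vector which belongs to the tree `τ`, as a linear form. -/
noncomputable def testCoord (τ : LWTree) : (Fin (testDim S) → ℝ) →L[ℝ] ℝ :=
  if h : τ ∈ S then ContinuousLinearMap.proj (testIndex S (some ⟨τ, h⟩)) else 0

variable {S}

theorem testCoord_testVec {τ : LWTree} (h : τ ∈ S) (c : ℝ) (f : LWTree → ℝ) :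
    testCoord S τ (testVec S c f) = f τ := by
  simp [testCoord, testVec, h]

theorem testVec_congr {f g : LWTree → ℝ} (c : ℝ) (h : ∀ τ ∈ S, f τ = g τ) :
    testVec S c f = testVec S c g := by
  funext i
  unfold testVec
  rcases (testIndex S).symm i with _ | τ
  · rfl
  · exact h τ τ.2

theorem fieldWeight_congr (hS : SubtreeClosed S) {c d : LWTree → ℝ} (h : ∀ τ ∈ S, c τ = d τ)
    {τ : LWTree} (hτ : τ ∈ S) : fieldWeight c τ = fieldWeight d τ := by
  cases τ with
  | meagre m τ => exact Finset.prod_congr rfl fun i _ => h _ (hS.meagre _ _ hτ i)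
  | fatLeaf q => rfl
  | fat q τ => rfl

variable (S)

/-- The right-hand side of the test problem. -/
noncomputable def testField (y : Fin (testDim S) → ℝ) : Fin (testDim S) → ℝ :=
  testVec S 0 (fieldWeight fun τ => testCoord S τ y)

/-- The coordinates of the linear term of the test problem. -/
noncomputable def testForm (x : ℝ) : LWTree → (Fin (testDim S) → ℝ) →L[ℝ] ℝ
  | meagre _ _ => 0
  | fatLeaf q => x ^ q • ContinuousLinearMap.proj (testIndex S none)
  | fat q τ => x ^ q • testCoord S τ

/-- The linear term of the test problem. -/
noncomputable def testLinear (x : ℝ) : (Fin (testDim S) → ℝ) →L[ℝ] (Fin (testDim S) → ℝ) :=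
  ContinuousLinearMap.pi fun i => ((testIndex S).symm i).elim 0 fun τ => testForm S x τ

theorem contDiff_testField : ContDiff ℝ ∞ (testField S) := by
  rw [contDiff_pi]
  intro i
  unfold testField testVec
  rcases (testIndex S).symm i with _ | ⟨τ, hτ⟩
  · exact contDiff_const
  · cases τ with
    | meagre m τ =>
      change ContDiff ℝ ∞ fun y => ∏ i, testCoord S (τ i) y
      exact contDiff_prod fun i _ => (testCoord S (τ i)).contDiff
    | fatLeaf q => exact contDiff_const
    | fat q τ => exact contDiff_const

theorem contDiff_testLinear : ContDiff ℝ ∞ (testLinear S) := by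
  rw [contDiff_clm_apply_iff]
  intro y
  rw [contDiff_pi]
  intro i
  simp only [testLinear, ContinuousLinearMap.pi_apply]
  rcases (testIndex S).symm i with _ | ⟨τ, hτ⟩
  · exact contDiff_const
  · cases τ with
    | meagre m τ => exact contDiff_const
    | fatLeaf q => exact (contDiff_id.pow q).mul contDiff_const
    | fat q τ => exact (contDiff_id.pow q).mul contDiff_const

variable {S}

/-- Subtree-closedness ensures that `testCoord` never falls back to its default 0 on a factor of the
product. -/
theorem testField_testVec (hS : SubtreeClosed S) (c : ℝ) (f : LWTree → ℝ) :
    testField S (testVec S c f) = testVec S 0 (fieldWeight f) :=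
  testVec_congr _ fun _ hτ => fieldWeight_congr hS (fun _ h => testCoord_testVec h c f) hτ

/-- The constant coordinate 1 plays the role of `yₙ`: a linear map needs it to produce the
inhomogeneous value `x ^ q` of a fat leaf. -/
theorem testLinear_testVec (hS : SubtreeClosed S) (x : ℝ) (f : LWTree → ℝ) :
    testLinear S x (testVec S 1 f) = testVec S 0 (linearWeight x f) := by
  funext i
  simp only [testLinear, ContinuousLinearMap.pi_apply]
  rw [testVec]
  rcases (testIndex S).symm i with _ | ⟨τ, hτ⟩
  · rfl
  · cases τ with
    | meagre m τ => rfl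
    | fatLeaf q => simp [testForm, testVec, linearWeight]
    | fat q τ => simp [testForm, linearWeight, testCoord_testVec (hS.fat _ _ hτ)]

theorem testVec_step {s : ℕ} (a b : Fin s → ℝ) (h : ℝ) (f g : Fin s → LWTree → ℝ) :
    testVec S 1 0 + h • ∑ k, a k • testVec S 0 (f k) + h • ∑ k, b k • testVec S 0 (g k) =
      testVec S 1 fun τ => h * (∑ k, a k * f k τ + ∑ k, b k * g k τ) := by
  funext i
  simp only [testVec, Pi.add_apply, Pi.smul_apply, Finset.sum_apply]
  rcases (testIndex S).symm i with _ | ⟨τ, hτ⟩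
  · simp
  · simp [mul_add]

namespace Method

variable {s : ℕ} (M : Method s)

/-- Holds for every `h` without remainder, because the coordinate of `τ` in the field or linear term
involves only the subtrees at its root. -/
theorem isStages_test (hS : SubtreeClosed S) (h : ℝ) :
    M.IsStages (testField S) (testLinear S) 0 (testVec S 1 0) h fun j =>
      testVec S 1 fun τ => h ^ τ.order * M.phiBar τ j := by
  intro j
  simp only [testField_testVec hS, testLinear_testVec hS, zero_add]
  rw [testVec_step]
  refine testVec_congr _ fun τ _ => ?_
  rw [phiBar_eq, mul_add, mul_add, Finset.mul_sum, Finset.mul_sum, Finset.mul_sum, Finset.mul_sum]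
  simp only [mul_left_comm h, mul_fieldWeight_pow, mul_linearWeight_pow, mul_left_comm (h ^ _)]

theorem output_test (hS : SubtreeClosed S) (h : ℝ) :
    M.output (testField S) (testLinear S) 0 (testVec S 1 0) h (fun j =>
      testVec S 1 fun τ => h ^ τ.order * M.phiBar τ j) =
      testVec S 1 fun τ => h ^ τ.order * ∑ j, M.phi τ j := by
  unfold output
  simp only [testField_testVec hS, testLinear_testVec hS, zero_add]
  rw [testVec_step]
  refine testVec_congr _ fun τ _ => ?_
  simp only [phi_eq]
  rw [Finset.sum_add_distrib, mul_add, mul_add, Finset.mul_sum, Finset.mul_sum, Finset.mul_sum,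
    Finset.mul_sum]
  simp only [mul_left_comm h, mul_fieldWeight_pow, mul_linearWeight_pow, mul_left_comm (h ^ _)]

end Method

theorem hasDerivAt_test (hS : SubtreeClosed S) (x : ℝ) :
    HasDerivAt (fun x => testVec S 1 fun τ => x ^ τ.order * exactWeight τ)
      (testField S (testVec S 1 fun τ => x ^ τ.order * exactWeight τ)) x := by
  rw [testField_testVec hS, hasDerivAt_pi]
  intro i
  unfold testVec
  rcases (testIndex S).symm i with _ | ⟨τ, hτ⟩
  · exact hasDerivAt_const _ _
  · simp only [Option.elim_some]
    refine ((hasDerivAt_pow τ.order x).mul_const (exactWeight τ)).congr_deriv ?_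
    rw [mul_right_comm, order_mul_exactWeight]
    cases τ with
    | meagre m τ =>
      simp only [fieldWeight, order, Finset.prod_mul_distrib, Finset.prod_pow_eq_pow_sum,
        add_tsub_cancel_left, mul_comm]
    | fatLeaf q => simp [fieldWeight]
    | fat q τ => simp [fieldWeight]

end TestProblem

/-- Dividing by `x ^ n` leaves the positive power `p + 1 - n` on the right, which tends to 0. -/
theorem eq_zero_of_mul_pow_le {d C : ℝ} {n p : ℕ} (hn : n ≤ p)
    (h : ∀ᶠ x in 𝓝[>] (0 : ℝ), ‖x ^ n * d‖ ≤ C * x ^ (p + 1)) : d = 0 := by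
  have h1 : ∀ᶠ x in 𝓝[>] (0 : ℝ), ‖d‖ ≤ C * x ^ (p + 1 - n) := by
    filter_upwards [h, self_mem_nhdsWithin] with x hx hx0
    have hx0 : 0 < x := hx0
    rw [norm_mul, norm_pow, Real.norm_of_nonneg hx0.le] at hx
    have h2 : x ^ (p + 1) = x ^ n * x ^ (p + 1 - n) := by
      rw [← pow_add]; congr 1; omega
    rw [h2, mul_left_comm] at hx
    exact le_of_mul_le_mul_left hx (pow_pos hx0 n)
  have h2 : Tendsto (fun x : ℝ => C * x ^ (p + 1 - n)) (𝓝[>] 0) (𝓝 0) := by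
    have : Continuous fun x : ℝ => C * x ^ (p + 1 - n) := by fun_prop
    have h3 := this.tendsto 0
    rw [zero_pow (by omega), mul_zero] at h3
    exact h3.mono_left nhdsWithin_le_nhds
  exact norm_le_zero_iff.1 (ge_of_tendsto h2 h1)

theorem Method.HasOrder.sum_phi_eq {s p : ℕ} {M : Method s} (h : M.HasOrder p) {τ : LWTree}
    (hτ : τ.order ≤ p) : ∑ j, M.phi τ j = exactWeight τ := by
  obtain ⟨S, hτS, hS⟩ := exists_subtreeClosed τ
  have h0 : (testVec S 1 fun τ => (0 : ℝ) ^ τ.order * exactWeight τ) = testVec S 1 0 :=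
    testVec_congr _ fun τ _ => by simp [(order_pos τ).ne']
  obtain ⟨C, hC⟩ := h _ (testField S) (testLinear S) 0 1
    (fun x => testVec S 1 fun τ => x ^ τ.order * exactWeight τ) (contDiff_testField S)
    (contDiff_testLinear S) zero_lt_one fun t _ => (hasDerivAt_test hS t).hasDerivWithinAt
  rw [h0] at hC
  refine (sub_eq_zero.1 (eq_zero_of_mul_pow_le (C := C) hτ ?_)).symm
  filter_upwards [hC] with x hx
  refine le_trans ?_ (hx.2 _ (M.isStages_test hS x))
  rw [M.output_test hS]
  -- The sup norm of the error dominates its coordinate at `τ`.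
  refine le_trans (le_of_eq ?_) (norm_le_pi_norm _ (testIndex S (some ⟨τ, hτS⟩)))
  simp [testVec, mul_sub]

/-! ### Finite truncations of the set of trees -/

namespace LWTree

open Classical in
/-- A finite set of trees which contains all trees of height at most `k` with less than `k`
children at a meagre vertex and less than `k` consecutive square vertices. -/
noncomputable def truncation : ℕ → Finset LWTree
  | 0 => ∅
  | k + 1 =>
    ((Finset.range (k + 1)).biUnion fun m =>
      (Fintype.piFinset fun _ : Fin m => truncation k).image (meagre m)) ∪
    ((Finset.range (k + 1)).image fatLeaf ∪
      (Finset.range (k + 1) ×ˢ truncation k).image fun x => fat x.1 x.2)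

theorem sum_truncation_succ {V : Type*} [AddCommMonoid V] (k : ℕ) (f : LWTree → V) :
    ∑ τ ∈ truncation (k + 1), f τ =
      ∑ m ∈ Finset.range (k + 1), ∑ τ ∈ Fintype.piFinset fun _ : Fin m => truncation k,
        f (meagre m τ) +
      (∑ q ∈ Finset.range (k + 1), f (fatLeaf q) +
        ∑ q ∈ Finset.range (k + 1), ∑ τ ∈ truncation k, f (fat q τ)) := by
  classical
  rw [truncation, Finset.sum_union, Finset.sum_union, Finset.sum_biUnion, Finset.sum_image,
    Finset.sum_image, Finset.sum_product]
  · congr 1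
    refine Finset.sum_congr rfl fun m _ => ?_
    rw [Finset.sum_image]
    intro τ _ σ _ h
    cases h
    rfl
  · rintro ⟨q, τ⟩ _ ⟨q', τ'⟩ _ h
    cases h
    rfl
  · intro q _ q' _ h
    cases h
    rfl
  · intro m _ m' _ hm
    rw [Function.onFun, Finset.disjoint_left]
    rintro _ h1 h2
    simp only [Finset.mem_image] at h1 h2
    obtain ⟨τ, _, rfl⟩ := h1
    obtain ⟨σ, _, h⟩ := h2
    cases h
    exact hm rfl
  · rw [Finset.disjoint_left]
    rintro _ h1 h2
    simp only [Finset.mem_image] at h1 h2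
    obtain ⟨τ, _, rfl⟩ := h1
    obtain ⟨σ, _, h⟩ := h2
    cases h
  · rw [Finset.disjoint_left]
    rintro _ h1 h2
    simp only [Finset.mem_image, Finset.mem_biUnion, Finset.mem_union] at h1 h2
    obtain ⟨m, _, τ, _, rfl⟩ := h1
    rcases h2 with ⟨σ, _, h⟩ | ⟨σ, _, h⟩ <;> cases h

end LWTree

theorem isBigO_pow_pow {l : Filter ℝ} (hl : l ≤ 𝓝 0) {m n : ℕ} (h : m ≤ n) :
    (fun x : ℝ => x ^ n) =O[l] fun x => x ^ m := by
  rcases h.eq_or_lt with rfl | h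
  · exact isBigO_refl _ _
  · exact ((isLittleO_pow_pow h).mono hl).isBigO

theorem tendsto_zero_of_isBigO {E : Type*} [NormedAddCommGroup E] {l : Filter ℝ}
    (hl : l ≤ 𝓝 0) {v : ℝ → E} (hv : v =O[l] fun h => h ^ 1) :
    Tendsto v l (𝓝 0) := by
  refine hv.trans_tendsto ?_
  simp only [pow_one]
  exact tendsto_id.mono_left hl

variable {E : Type*} [NormedAddCommGroup E] [NormedSpace ℝ E]

/-! ### Tree series inserted into the nonlinear and linear terms -/

section Expansion

variable (A : ∀ m : ℕ, E [×m]→L[ℝ] E) (B : ℕ → E →L[ℝ] E) (y₀ : E)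

/-- The elementary differential of a tree, where `A m` and `B q` are the Taylor coefficients of
the nonlinear and the linear term. -/
noncomputable def elemDiff : LWTree → E
  | meagre m τ => A m fun i => elemDiff (τ i)
  | fatLeaf q => B q y₀
  | fat q τ => B q (elemDiff τ)

/-- The tree series with coefficients `c`, truncated. -/
noncomputable def treeSeries (k : ℕ) (c : LWTree → ℝ) (h : ℝ) : E :=
  ∑ τ ∈ truncation k, (h ^ τ.order * c τ) • elemDiff A B y₀ τ

variable {A B y₀}

/-- Multilinear expansion runs over ordered tuples of trees, that is, over the meagre trees one
level up. The truncations match, so this is an identity; the exponent lacks the root's factor `h`.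
-/
theorem sum_apply_treeSeries (k : ℕ) (c : LWTree → ℝ) (h : ℝ) :
    ∑ m ∈ Finset.range (k + 1), A m (fun _ => treeSeries A B y₀ k c h) =
      ∑ τ ∈ truncation (k + 1), (h ^ (τ.order - 1) * fieldWeight c τ) • elemDiff A B y₀ τ := by
  classical
  rw [sum_truncation_succ]
  simp only [fieldWeight, mul_zero, zero_smul, Finset.sum_const_zero, add_zero]
  refine Finset.sum_congr rfl fun m _ => ?_
  unfold treeSeries
  rw [ContinuousMultilinearMap.map_sum_finset]
  refine Finset.sum_congr rfl fun τ _ => ?_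
  rw [ContinuousMultilinearMap.map_smul_univ, Finset.prod_mul_distrib,
    Finset.prod_pow_eq_pow_sum, elemDiff, order, add_tsub_cancel_left]

theorem treeSeries_fieldWeight (k : ℕ) (c : LWTree → ℝ) (h : ℝ) :
    treeSeries A B y₀ (k + 1) (fieldWeight c) h =
      h • ∑ m ∈ Finset.range (k + 1), A m (fun _ => treeSeries A B y₀ k c h) := by
  rw [sum_apply_treeSeries, Finset.smul_sum, treeSeries]
  refine Finset.sum_congr rfl fun τ _ => ?_
  rw [smul_smul, ← mul_assoc, mul_pow_sub_one (order_pos τ).ne']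

/-- The summand `y₀` yields the fat leaves, the series yields the trees grafted on a fat vertex. -/
theorem treeSeries_linearWeight (k : ℕ) (γ : ℝ) (c : LWTree → ℝ) (h : ℝ) :
    treeSeries A B y₀ (k + 1) (linearWeight γ c) h =
      h • ∑ q ∈ Finset.range (k + 1), (h * γ) ^ q • B q (y₀ + treeSeries A B y₀ k c h) := by
  rw [treeSeries, sum_truncation_succ]
  simp only [linearWeight, mul_zero, zero_smul, Finset.sum_const_zero, zero_add]
  rw [← Finset.sum_add_distrib, Finset.smul_sum]
  refine Finset.sum_congr rfl fun q _ => ?_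
  rw [map_add, smul_add, smul_add, elemDiff, smul_smul, order, treeSeries, map_sum,
    Finset.smul_sum, Finset.smul_sum]
  congr 1
  · congr 1
    ring
  · refine Finset.sum_congr rfl fun τ _ => ?_
    rw [map_smul, smul_smul, smul_smul, elemDiff, order]
    congr 1
    ring

theorem hasDerivAt_treeSeries_exactWeight (k : ℕ) (h : ℝ) :
    HasDerivAt (treeSeries A B y₀ (k + 1) exactWeight)
      (∑ m ∈ Finset.range (k + 1), A m (fun _ => treeSeries A B y₀ k exactWeight h)) h := by
  rw [sum_apply_treeSeries]
  unfold treeSeries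
  refine HasDerivAt.fun_sum fun τ _ => ?_
  refine (((hasDerivAt_pow τ.order h).mul_const _).smul_const _).congr_deriv ?_
  rw [mul_right_comm, order_mul_exactWeight, mul_comm]

theorem treeSeries_zero_right (k : ℕ) (c : LWTree → ℝ) : treeSeries A B y₀ k c 0 = 0 :=
  Finset.sum_eq_zero fun τ _ => by simp [(order_pos τ).ne']

variable {l : Filter ℝ}

theorem isBigO_treeSeries (hl : l ≤ 𝓝 0) {k n : ℕ} {c : LWTree → ℝ}
    (hc : ∀ τ : LWTree, τ.order < n → c τ = 0) :
    treeSeries A B y₀ k c =O[l] fun h => h ^ n := by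
  unfold treeSeries
  refine IsBigO.fun_sum fun τ _ => ?_
  by_cases hτ : τ.order < n
  · simp only [hc τ hτ, mul_zero, zero_smul]
    exact isBigO_zero _ _
  · have h1 : (fun h : ℝ => (h ^ τ.order * c τ) • elemDiff A B y₀ τ) =O[l]
        fun h => h ^ τ.order :=
      IsBigO.of_bound (‖c τ‖ * ‖elemDiff A B y₀ τ‖) (Eventually.of_forall fun h => by
        rw [norm_smul, norm_mul]; exact le_of_eq (by ring))
    exact h1.trans (isBigO_pow_pow hl (not_lt.1 hτ))

theorem isBigO_treeSeries_id (hl : l ≤ 𝓝 0) (k : ℕ) (c : LWTree → ℝ) :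
    treeSeries A B y₀ k c =O[l] fun h => h ^ 1 :=
  isBigO_treeSeries hl (c := c) fun τ h => absurd (order_pos τ) (by omega)

theorem isBigO_of_sub_treeSeries (hl : l ≤ 𝓝 0) {v : ℝ → E} {k : ℕ} {c : LWTree → ℝ}
    (hv : (fun h => v h - treeSeries A B y₀ k c h) =O[l] fun h => h ^ (k + 1)) :
    v =O[l] fun h => h ^ 1 := by
  have h1 : (fun h : ℝ => h ^ (k + 1)) =O[l] fun h => h ^ 1 := isBigO_pow_pow hl (by omega)
  exact ((hv.trans h1).add (isBigO_treeSeries_id hl k c)).congr_left fun h => sub_add_cancel _ _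

/-- A multilinear map is Lipschitz on the unit ball, where both arguments eventually lie. -/
theorem isBigO_multilinear_sub {m : ℕ} (T : E [×m]→L[ℝ] E) {u v : ℝ → E} {g : ℝ → ℝ}
    (hu : Tendsto u l (𝓝 0)) (hv : Tendsto v l (𝓝 0)) (huv : (fun h => v h - u h) =O[l] g) :
    (fun h => T (fun _ => v h) - T (fun _ => u h)) =O[l] g := by
  refine IsBigO.trans (IsBigO.of_bound (‖T‖ * m) ?_) huv
  filter_upwards [hu.norm.eventually (ge_mem_nhds (norm_zero.trans_lt one_pos)),
    hv.norm.eventually (ge_mem_nhds (norm_zero.trans_lt one_pos))] with h h1 h2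
  refine (T.norm_image_sub_le _ _).trans ?_
  rw [Fintype.card_fin]
  have h3 : ‖fun _ : Fin m => v h‖ ≤ 1 := (pi_norm_const_le _).trans h2
  have h4 : ‖fun _ : Fin m => u h‖ ≤ 1 := (pi_norm_const_le _).trans h1
  have h5 : ‖(fun _ : Fin m => v h) - fun _ => u h‖ ≤ ‖v h - u h‖ :=
    pi_norm_const_le (v h - u h)
  calc _ ≤ ‖T‖ * m * 1 ^ (m - 1) * ‖v h - u h‖ := by
        gcongr
        exact max_le h3 h4
    _ = _ := by rw [one_pow, mul_one]

/-- Two errors add up: the Taylor remainder at `v = O(h)`, and the replacement of `v` by its series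
in the Taylor polynomial. -/
theorem isBigO_field_sub (hl : l ≤ 𝓝 0) {F : E → E} {v : ℝ → E} {k : ℕ} {c : LWTree → ℝ}
    (hF : (fun v => F (y₀ + v) - ∑ m ∈ Finset.range (k + 1), A m (fun _ => v)) =O[𝓝 0]
      fun v => ‖v‖ ^ (k + 1))
    (hv : (fun h => v h - treeSeries A B y₀ k c h) =O[l] fun h => h ^ (k + 1)) :
    (fun h => F (y₀ + v h) -
      ∑ m ∈ Finset.range (k + 1), A m (fun _ => treeSeries A B y₀ k c h)) =O[l]
      fun h => h ^ (k + 1) := by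
  have hv1 := isBigO_of_sub_treeSeries hl hv
  have hv0 := tendsto_zero_of_isBigO hl hv1
  have h0 : ((fun v : E => ‖v‖ ^ (k + 1)) ∘ v) =O[l] fun h => h ^ (k + 1) := by
    simpa [Function.comp_def] using hv1.norm_left.pow (k + 1)
  have h1 := (hF.comp_tendsto hv0).trans h0
  have h2 : (fun h => ∑ m ∈ Finset.range (k + 1),
      (A m (fun _ => v h) - A m (fun _ => treeSeries A B y₀ k c h))) =O[l]
      fun h => h ^ (k + 1) := IsBigO.fun_sum fun m _ => isBigO_multilinear_sub (A m)
    (tendsto_zero_of_isBigO hl (isBigO_treeSeries_id hl k c)) hv0 hv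
  simpa [Function.comp_def] using h1.add h2

theorem isBigO_smul_field_sub (hl : l ≤ 𝓝 0) {F : E → E} {v : ℝ → E} {k : ℕ} {c : LWTree → ℝ}
    (hF : (fun v => F (y₀ + v) - ∑ m ∈ Finset.range (k + 1), A m (fun _ => v)) =O[𝓝 0]
      fun v => ‖v‖ ^ (k + 1))
    (hv : (fun h => v h - treeSeries A B y₀ k c h) =O[l] fun h => h ^ (k + 1)) :
    (fun h => h • F (y₀ + v h) - treeSeries A B y₀ (k + 1) (fieldWeight c) h) =O[l]
      fun h => h ^ (k + 2) := by
  have h1 := (isBigO_refl (fun h : ℝ => h) l).smul (isBigO_field_sub hl hF hv)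
  simp only [smul_sub, ← treeSeries_fieldWeight, smul_eq_mul, ← pow_succ'] at h1
  exact h1

theorem isBigO_smul_linear_sub (hl : l ≤ 𝓝 0) {L : ℝ → E →L[ℝ] E} {t γ : ℝ} {v : ℝ → E} {k : ℕ}
    {c : LWTree → ℝ}
    (hL : (fun x => L (t + x) - ∑ q ∈ Finset.range (k + 1), x ^ q • B q) =O[𝓝 0]
      fun x => x ^ (k + 1))
    (hv : (fun h => v h - treeSeries A B y₀ k c h) =O[l] fun h => h ^ (k + 1)) :
    (fun h => h • L (t + h * γ) (y₀ + v h) -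
      treeSeries A B y₀ (k + 1) (linearWeight γ c) h) =O[l] fun h => h ^ (k + 2) := by
  have hv0 := tendsto_zero_of_isBigO hl (isBigO_of_sub_treeSeries hl hv)
  have hγ : Tendsto (fun h : ℝ => h * γ) l (𝓝 0) := by
    simpa using (tendsto_id.mono_left hl).mul_const γ
  have hγO : ((fun x : ℝ => x ^ (k + 1)) ∘ fun h => h * γ) =O[l] fun h => h ^ (k + 1) := by
    simp only [Function.comp_def, mul_pow, mul_comm _ (γ ^ _)]
    exact (isBigO_refl _ _).const_mul_left _
  have h1 := (hL.comp_tendsto hγ).trans hγO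
  have h2 : (fun h => y₀ + v h) =O[l] fun _ => (1 : ℝ) :=
    (tendsto_const_nhds.add hv0).isBigO_one ℝ
  -- Taylor remainder of `L`, applied to a bounded vector; `h4` then treats the error of `v` under
  -- the Taylor polynomial of `L`.
  have h3 : (fun h => (L (t + h * γ) - ∑ q ∈ Finset.range (k + 1), (h * γ) ^ q • B q)
      (y₀ + v h)) =O[l] fun h => h ^ (k + 1) := by
    refine (IsBigO.of_bound 1 (Eventually.of_forall fun h => ?_)).trans
      ((h1.norm_left.mul h2.norm_left).congr_right fun h => mul_one _)
    rw [one_mul, Real.norm_of_nonneg (by positivity)]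
    exact ContinuousLinearMap.le_opNorm _ _
  have h4 : (fun h => ∑ q ∈ Finset.range (k + 1),
      (h * γ) ^ q • B q (v h - treeSeries A B y₀ k c h)) =O[l] fun h => h ^ (k + 1) := by
    refine IsBigO.fun_sum fun q _ => ?_
    have h5 := ((hγ.pow q).isBigO_one ℝ).smul (((B q).isBigO_comp _ l).trans hv)
    simpa using h5
  have h6 := (isBigO_refl (fun h : ℝ => h) l).smul (h3.add h4)
  simp only [smul_eq_mul, ← pow_succ'] at h6
  refine h6.congr_left fun h => ?_
  rw [treeSeries_linearWeight, ← smul_sub]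
  congr 1
  simp only [sub_apply, sum_apply,
    smul_apply, map_add, map_sub, smul_add, smul_sub,
    Finset.sum_add_distrib, Finset.sum_sub_distrib]
  abel

end Expansion

/-! ### Expansion of the exact solution -/

section ExactSolution

variable {A : ∀ m : ℕ, E [×m]→L[ℝ] E} {B : ℕ → E →L[ℝ] E}

/-- Mean value inequality on `[0, x]`: integrating the derivative bound gains one power. -/
theorem isBigO_of_hasDerivWithinAt {R R' : ℝ → E} {T : ℝ} (hT : 0 < T) (h0 : R 0 = 0)
    (hR : ∀ x ∈ Set.Icc 0 T, HasDerivWithinAt R (R' x) (Set.Icc 0 T) x) {n : ℕ}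
    (hR' : R' =O[𝓝[≥] 0] fun x => x ^ n) : R =O[𝓝[≥] 0] fun x => x ^ (n + 1) := by
  obtain ⟨C, hC0, hC⟩ := hR'.exists_nonneg
  obtain ⟨δ, hδ, hsub⟩ := mem_nhdsGE_iff_exists_Ico_subset.1 hC.bound
  refine IsBigO.of_bound C ?_
  filter_upwards [Ico_mem_nhdsGE (lt_min hT hδ)] with x hx
  have hxT : x ≤ T := (hx.2.trans_le (min_le_left _ _)).le
  have hxδ : x < δ := hx.2.trans_le (min_le_right _ _)
  have key := Convex.norm_image_sub_le_of_norm_hasDerivWithin_le (f := R) (f' := R')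
    (s := Set.Icc 0 x) (C := C * x ^ n) (x := 0) (y := x)
    (fun z hz => (hR z ⟨hz.1, hz.2.trans hxT⟩).mono (Set.Icc_subset_Icc_right hxT))
    (fun z hz => by
      refine le_trans (hsub ⟨hz.1, hz.2.trans_lt hxδ⟩) ?_
      rw [Real.norm_of_nonneg (pow_nonneg hz.1 _)]
      exact mul_le_mul_of_nonneg_left (pow_le_pow_left₀ hz.1 hz.2 _) hC0)
    (convex_Icc _ _) (by simp [hx.1]) (by simp [hx.1])
  rw [h0, sub_zero, sub_zero] at key
  rw [norm_pow]
  rw [Real.norm_of_nonneg hx.1] at key ⊢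
  rwa [pow_succ, ← mul_assoc]

/-- The expansion of the exact solution. -/
theorem isBigO_solution_sub {F : E → E} {y : ℝ → E} {T : ℝ} (hT : 0 < T)
    (hF : ∀ n, (fun v => F (y 0 + v) - ∑ m ∈ Finset.range (n + 1), A m (fun _ => v)) =O[𝓝 0]
      fun v => ‖v‖ ^ (n + 1))
    (hy : ∀ x ∈ Set.Icc 0 T, HasDerivWithinAt y (F (y x)) (Set.Icc 0 T) x) (k : ℕ) :
    (fun h => y h - y 0 - treeSeries A B (y 0) k exactWeight h) =O[𝓝[≥] 0]
      fun h => h ^ (k + 1) := by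
  induction k with
  | zero =>
    have h0 := (hy 0 ⟨le_rfl, hT.le⟩).hasFDerivWithinAt.isBigO_sub
    rw [nhdsWithin_Icc_eq_nhdsGE hT] at h0
    simpa [treeSeries, truncation] using h0
  | succ k ih =>
    -- The expansion at level `k`, inserted into `F`, bounds the derivative of the remainder at
    -- level `k + 1`.
    have h1 := isBigO_field_sub (A := A) (B := B) nhdsWithin_le_nhds (hF k) ih
    simp only [add_sub_cancel] at h1
    refine isBigO_of_hasDerivWithinAt hT ?_ (fun x hx => ?_) h1
    · simp [treeSeries_zero_right]
    · exact ((hy x hx).sub_const _).sub (hasDerivAt_treeSeries_exactWeight k x).hasDerivWithinAt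

end ExactSolution

theorem tendsto_clm_apply {α : Type*} {l : Filter α} {T : α → E →L[ℝ] E} {v : α → E}
    {T₀ : E →L[ℝ] E} {v₀ : E} (hT : Tendsto T l (𝓝 T₀)) (hv : Tendsto v l (𝓝 v₀)) :
    Tendsto (fun x => T x (v x)) l (𝓝 (T₀ v₀)) :=
  (isBoundedBilinearMap_apply.continuous.tendsto (T₀, v₀)).comp (hT.prodMk_nhds hv)

/-! ### Triangular systems -/

section Triangular

variable {s : ℕ} {V : Type*}

theorem exists_triangular_solution [Zero V] (R : Fin s → (Fin s → V) → V)
    (hR : ∀ i Y Z, (∀ j < i, Y j = Z j) → R i Y = R i Z) : ∃ Y : Fin s → V, ∀ i, Y i = R i Y := by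
  classical
  let Y : Fin s → V := (wellFounded_lt (α := Fin s)).fix fun i ih =>
    -- The value 0 at the unknown entries is harmless: `R i` reads only entries before `i`.
    R i fun j => if hj : j < i then ih j hj else 0
  refine ⟨Y, fun i => ?_⟩
  refine (WellFounded.fix_eq _ _ i).trans (hR _ _ _ fun j hj => ?_)
  simp only [hj, dif_pos]
  rfl

theorem triangular_solution_unique {R : Fin s → (Fin s → V) → V}
    (hR : ∀ i Y Z, (∀ j < i, Y j = Z j) → R i Y = R i Z) {Y Z : Fin s → V}
    (hY : ∀ i, Y i = R i Y) (hZ : ∀ i, Z i = R i Z) : Y = Z := by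
  funext i
  induction i using WellFoundedLT.induction with
  | ind i ih => rw [hY, hZ, hR i Y Z ih]

end Triangular

/-! ### Expansion of the method and sufficiency -/

namespace Method

variable {s : ℕ} (M : Method s)

section Expansion

variable {A : ∀ m : ℕ, E [×m]→L[ℝ] E} {B : ℕ → E →L[ℝ] E} {y₀ : E}

/-- The weights `a`, `b` are arbitrary so that it serves both a stage row and the output. -/
theorem isBigO_increment_sub {F : E → E} {L : ℝ → E →L[ℝ] E} {t : ℝ} {l : Filter ℝ}
    (hl : l ≤ 𝓝 0) {k : ℕ}
    (hF : (fun v => F (y₀ + v) - ∑ m ∈ Finset.range (k + 1), A m (fun _ => v)) =O[𝓝 0]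
      fun v => ‖v‖ ^ (k + 1))
    (hL : (fun x => L (t + x) - ∑ q ∈ Finset.range (k + 1), x ^ q • B q) =O[𝓝 0]
      fun x => x ^ (k + 1))
    {Y : ℝ → Fin s → E} {γ : Fin s → ℝ} {c : Fin s → LWTree → ℝ}
    (hY : ∀ j, (fun h => Y h j - y₀ - treeSeries A B y₀ k (c j) h) =O[l] fun h => h ^ (k + 1))
    (a b : Fin s → ℝ) :
    (fun h => h • ∑ j, a j • F (Y h j) + h • ∑ j, b j • L (t + h * γ j) (Y h j) -
      treeSeries A B y₀ (k + 1) (fun τ => ∑ j, a j * fieldWeight (c j) τ +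
        ∑ j, b j * linearWeight (γ j) (c j) τ) h) =O[l] fun h => h ^ (k + 2) := by
  have h1 : (fun h => ∑ j, a j • (h • F (y₀ + (Y h j - y₀)) -
      treeSeries A B y₀ (k + 1) (fieldWeight (c j)) h)) =O[l] fun h => h ^ (k + 2) :=
    IsBigO.fun_sum fun j _ => (isBigO_smul_field_sub hl hF (hY j)).const_smul_left _
  have h2 : (fun h => ∑ j, b j • (h • L (t + h * γ j) (y₀ + (Y h j - y₀)) -
      treeSeries A B y₀ (k + 1) (linearWeight (γ j) (c j)) h)) =O[l] fun h => h ^ (k + 2) :=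
    IsBigO.fun_sum fun j _ => (isBigO_smul_linear_sub hl hL (hY j)).const_smul_left _
  refine (h1.add h2).congr_left fun h => ?_
  have h3 : treeSeries A B y₀ (k + 1) (fun τ => ∑ j, a j * fieldWeight (c j) τ +
        ∑ j, b j * linearWeight (γ j) (c j) τ) h =
      ∑ j, a j • treeSeries A B y₀ (k + 1) (fieldWeight (c j)) h +
        ∑ j, b j • treeSeries A B y₀ (k + 1) (linearWeight (γ j) (c j)) h := by
    simp only [treeSeries, Finset.smul_sum, smul_smul]
    rw [Finset.sum_comm, Finset.sum_comm (s := Finset.univ), ← Finset.sum_add_distrib]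
    refine Finset.sum_congr rfl fun τ _ => ?_
    rw [mul_add, add_smul, Finset.mul_sum, Finset.mul_sum, Finset.sum_smul, Finset.sum_smul]
    simp only [mul_left_comm]
  rw [h3]
  simp only [add_sub_cancel, smul_sub, Finset.sum_sub_distrib, Finset.smul_sum, smul_comm h]
  abel

end Expansion

section Stages

variable (F : E → E) (L : ℝ → E →L[ℝ] E) (t : ℝ) (y₀ : E)

/-- The right-hand side of the stage equations, solved for the stage `i`. -/
noncomputable def stageRhs (h : ℝ) (i : Fin s) (Y : Fin s → E) : E :=
  Ring.inverse (1 - (h * M.γ i i) • L (t + h * M.γ i i))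
    (y₀ + ∑ j, (h * M.a i j) • F (Y j) +
      ∑ j ∈ Finset.univ.erase i, (h * M.γ i j) • L (t + h * M.γ j j) (Y j))

theorem stageRhs_congr (h : ℝ) (i : Fin s) (Y Z : Fin s → E) (hYZ : ∀ j < i, Y j = Z j) :
    M.stageRhs F L t y₀ h i Y = M.stageRhs F L t y₀ h i Z := by
  unfold stageRhs
  congr 2
  · congr 1
    refine Finset.sum_congr rfl fun j _ => ?_
    rcases lt_or_ge j i with hj | hj
    · rw [hYZ j hj]
    · simp [M.a_eq_zero i j hj]
  · refine Finset.sum_congr rfl fun j hji => ?_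
    rcases lt_or_ge j i with hj | hj
    · rw [hYZ j hj]
    · simp [M.γ_eq_zero i j (lt_of_le_of_ne hj (Finset.ne_of_mem_erase hji).symm)]

/-- Stage `i` is implicit only through its diagonal linear term, and the unit hypothesis allows
solving for it. -/
theorem eq_stageRhs_iff {h : ℝ} {i : Fin s} {Y : Fin s → E}
    (hu : IsUnit (1 - (h * M.γ i i) • L (t + h * M.γ i i))) :
    Y i = M.stageRhs F L t y₀ h i Y ↔
      Y i = y₀ + h • ∑ j, M.a i j • F (Y j) +
        h • ∑ j, M.γ i j • L (t + h * M.γ j j) (Y j) := by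
  have h1 := Ring.inverse_mul_cancel _ hu
  have h2 := Ring.mul_inverse_cancel _ hu
  have h3 : ∀ x z : E, x = Ring.inverse (1 - (h * M.γ i i) • L (t + h * M.γ i i)) z ↔
      (1 - (h * M.γ i i) • L (t + h * M.γ i i)) x = z := fun x z =>
    ⟨fun hx => by rw [hx]; exact DFunLike.congr_fun h2 z,
      fun hz => by rw [← hz]; exact (DFunLike.congr_fun h1 x).symm⟩
  rw [stageRhs, h3, ← Finset.add_sum_erase _ (fun j => M.γ i j • L (t + h * M.γ j j) (Y j))
    (Finset.mem_univ i)]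
  simp only [sub_apply, one_apply_eq_self,
    smul_apply, smul_add, Finset.smul_sum, smul_smul]
  rw [sub_eq_iff_eq_add]
  refine iff_of_eq (congrArg _ ?_)
  abel

variable {F L}

theorem tendsto_one_sub (hL : Continuous L) (γ : ℝ) :
    Tendsto (fun h : ℝ => 1 - (h * γ) • L (t + h * γ)) (𝓝 0) (𝓝 1) := by
  have h1 : Continuous fun h : ℝ => 1 - (h * γ) • L (t + h * γ) := by fun_prop
  simpa using h1.tendsto 0

variable [CompleteSpace E]

theorem eventually_isUnit (hL : Continuous L) :
    ∀ᶠ h in 𝓝 (0 : ℝ), ∀ i, IsUnit (1 - (h * M.γ i i) • L (t + h * M.γ i i)) :=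
  eventually_all.2 fun i =>
    (tendsto_one_sub t hL (M.γ i i)).eventually (Units.isOpen.mem_nhds isUnit_one)

/-- Starts the bootstrap: stages near `y₀` have bounded increments per `h`. Induction over the
stages works because the solved form involves only earlier ones. -/
theorem tendsto_stages (hF : Continuous F) (hL : Continuous L) {Y : ℝ → Fin s → E}
    (hY : ∀ h i, Y h i = M.stageRhs F L t y₀ h i (Y h)) (i : Fin s) :
    Tendsto (fun h => Y h i) (𝓝 0) (𝓝 y₀) := by
  induction i using WellFoundedLT.induction with
  | ind i ih =>
    have h1 : Tendsto (fun h : ℝ => Ring.inverse (1 - (h * M.γ i i) • L (t + h * M.γ i i)))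
        (𝓝 0) (𝓝 1) := by
      have h2 := (NormedRing.inverse_continuousAt (1 : (E →L[ℝ] E)ˣ)).tendsto
      rw [Units.val_one, Ring.inverse_one] at h2
      exact h2.comp (tendsto_one_sub t hL _)
    have hm : ∀ c : ℝ, Tendsto (fun h : ℝ => h * c) (𝓝 0) (𝓝 0) := fun c => by
      simpa using (tendsto_id (α := ℝ) (x := 𝓝 0)).mul_const c
    have h3 : Tendsto (fun h => ∑ j, (h * M.a i j) • F (Y h j)) (𝓝 0)
        (𝓝 (∑ _j : Fin s, (0 : E))) := by
      refine tendsto_finsetSum _ fun j _ => ?_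
      rcases lt_or_ge j i with hj | hj
      · simpa using (hm _).smul ((hF.tendsto y₀).comp (ih j hj))
      · simp [M.a_eq_zero i j hj]
    have h4 : Tendsto (fun h => ∑ j ∈ Finset.univ.erase i,
        (h * M.γ i j) • L (t + h * M.γ j j) (Y h j)) (𝓝 0)
        (𝓝 (∑ _j ∈ Finset.univ.erase i, (0 : E))) := by
      refine tendsto_finsetSum _ fun j hji => ?_
      rcases lt_or_ge j i with hj | hj
      · have h5 : Tendsto (fun h : ℝ => L (t + h * M.γ j j)) (𝓝 0) (𝓝 (L (t + 0))) :=
          (hL.tendsto _).comp (tendsto_const_nhds.add (hm _))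
        simpa using (hm (M.γ i j)).smul (tendsto_clm_apply h5 (ih j hj))
      · simp [M.γ_eq_zero i j (lt_of_le_of_ne hj (Finset.ne_of_mem_erase hji).symm)]
    rw [Finset.sum_const_zero] at h3 h4
    have h6 := tendsto_clm_apply h1 ((tendsto_const_nhds (x := y₀)).add h3 |>.add h4)
    simpa only [hY _ i, stageRhs, add_zero, one_apply_eq_self] using h6

/-- Induction on `k` for all stages at once: inserting level `k` into the unsolved stage equations
gives level `k + 1`, so the inverse never has to be expanded. -/
theorem isBigO_stages_sub {A : ∀ m : ℕ, E [×m]→L[ℝ] E} {B : ℕ → E →L[ℝ] E}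
    (hFc : Continuous F) (hLc : Continuous L)
    (hF : ∀ n, (fun v => F (y₀ + v) - ∑ m ∈ Finset.range (n + 1), A m (fun _ => v)) =O[𝓝 0]
      fun v => ‖v‖ ^ (n + 1))
    (hL : ∀ n, (fun x => L (t + x) - ∑ q ∈ Finset.range (n + 1), x ^ q • B q) =O[𝓝 0]
      fun x => x ^ (n + 1))
    {Y : ℝ → Fin s → E} (hY : ∀ h i, Y h i = M.stageRhs F L t y₀ h i (Y h)) (k : ℕ)
    (i : Fin s) :
    (fun h => Y h i - y₀ - treeSeries A B y₀ k (fun τ => M.phiBar τ i) h) =O[𝓝 0]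
      fun h => h ^ (k + 1) := by
  have hY0 := M.tendsto_stages t y₀ hFc hLc hY
  have heq : ∀ i, ∀ᶠ h in 𝓝 (0 : ℝ), h • ∑ j, M.a i j • F (Y h j) +
      h • ∑ j, M.γ i j • L (t + h * M.γ j j) (Y h j) = Y h i - y₀ := fun i => by
    filter_upwards [M.eventually_isUnit t hLc] with h hu
    rw [((M.eq_stageRhs_iff F L t y₀ (hu i)).1 (hY h i))]
    abel
  induction k generalizing i with
  | zero =>
    have h1 : Tendsto (fun h => ∑ j, M.a i j • F (Y h j) +
        ∑ j, M.γ i j • L (t + h * M.γ j j) (Y h j)) (𝓝 0)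
        (𝓝 (∑ j, M.a i j • F y₀ + ∑ j, M.γ i j • L (t + 0 * M.γ j j) y₀)) := by
      refine (tendsto_finsetSum _ fun j _ => ?_).add (tendsto_finsetSum _ fun j _ => ?_)
      · exact ((hFc.tendsto y₀).comp (hY0 j)).const_smul _
      · have h5 : Continuous fun h : ℝ => L (t + h * M.γ j j) := by fun_prop
        exact (tendsto_clm_apply (h5.tendsto 0) (hY0 j)).const_smul _
    have h2 := (isBigO_refl (fun h : ℝ => h) (𝓝 0)).smul (h1.isBigO_one ℝ)
    refine h2.congr' ?_ (by simp)
    filter_upwards [heq i] with h hh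
    rw [smul_add, hh]
    simp [treeSeries, truncation]
  | succ k ih =>
    refine (isBigO_increment_sub le_rfl (hF k) (hL k) (γ := fun j => M.γ j j) ih (M.a i)
      (M.γ i)).congr' ?_ .rfl
    filter_upwards [heq i] with h hh
    simp only [hh, ← phiBar_eq]

end Stages

theorem hasOrder_of_sum_phi_eq {p : ℕ}
    (hM : ∀ τ : LWTree, τ.order ≤ p → ∑ j, M.phi τ j = exactWeight τ) : M.HasOrder p := by
  intro N F L tn tF y hFs hLs htF hy
  have hF := taylor_isBigO hFs (y tn)
  have hL := taylor_isBigO_real hLs tn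
  have hFc := hFs.continuous
  have hLc := hLs.continuous
  choose Y hY using fun h => exists_triangular_solution _ (M.stageRhs_congr F L tn (y tn) h)
  have hsolution : ∀ x ∈ Set.Icc 0 (tF - tn), HasDerivWithinAt (fun h => y (tn + h))
      (F (y (tn + x))) (Set.Icc 0 (tF - tn)) x := fun x hx => by
    have h1 := hy (tn + x) ⟨by linarith [hx.1], by linarith [hx.2]⟩
    have h2 : HasDerivWithinAt (fun h => tn + h) 1 (Set.Icc 0 (tF - tn)) x :=
      (hasDerivWithinAt_id x _).const_add tn
    have h3 := h1.scomp x h2 fun z hz => ⟨by linarith [hz.1], by linarith [hz.2]⟩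
    rw [one_smul] at h3
    exact h3
  have h1 := isBigO_solution_sub (A := fun m => (m.factorial : ℝ)⁻¹ • iteratedFDeriv ℝ m F (y tn))
    (B := fun q => (q.factorial : ℝ)⁻¹ • iteratedDeriv q L tn)
    (sub_pos.2 htF) (by simpa only [add_zero] using hF) hsolution (p + 1)
  simp only [add_zero] at h1
  have h2 := isBigO_increment_sub le_rfl (hF p) (hL p) (γ := fun j => M.γ j j)
    (M.isBigO_stages_sub tn (y tn) hFc hLc hF hL hY p) M.b M.g
  have h3 := (h1.mono (nhdsWithin_mono 0 Set.Ioi_subset_Ici_self)).sub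
    (h2.mono (nhdsWithin_le_nhds (s := Set.Ioi 0)))
  -- The difference of the two series has no coefficients of order at most `p`.
  have h4 := isBigO_treeSeries (l := 𝓝[>] 0)
    (A := fun m => (m.factorial : ℝ)⁻¹ • iteratedFDeriv ℝ m F (y tn))
    (B := fun q => (q.factorial : ℝ)⁻¹ • iteratedDeriv q L tn) (y₀ := y tn)
    nhdsWithin_le_nhds (k := p + 1) (n := p + 1)
    (c := fun τ => exactWeight τ - ∑ j, M.phi τ j)
    fun τ hτ => by rw [hM τ (by omega), sub_self]
  obtain ⟨C, hC⟩ := ((h3.trans (isBigO_pow_pow nhdsWithin_le_nhds (by omega))).add h4).bound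
  refine ⟨C, ?_⟩
  filter_upwards [hC, self_mem_nhdsWithin,
    nhdsWithin_le_nhds (M.eventually_isUnit tn hLc)] with h hh h0 hu
  have hiff : ∀ Z, M.IsStages F L tn (y tn) h Z ↔
      ∀ i, Z i = M.stageRhs F L tn (y tn) h i Z := fun Z =>
    forall_congr' fun i => (M.eq_stageRhs_iff F L tn (y tn) (hu i)).symm
  refine ⟨⟨Y h, (hiff _).2 (hY h)⟩, fun Z hZ => ?_⟩
  -- For small `h` the stages are unique, so the bound for `Y h` covers every solution.
  rw [triangular_solution_unique (M.stageRhs_congr F L tn (y tn) h) ((hiff Z).1 hZ) (hY h)]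
  rw [norm_pow, Real.norm_of_nonneg (le_of_lt h0)] at hh
  refine le_trans (le_of_eq (congrArg norm ?_)) hh
  have h5 : ∀ τ, ∑ j, M.phi τ j =
      ∑ j, M.b j * fieldWeight (fun τ => M.phiBar τ j) τ +
        ∑ j, M.g j * linearWeight (M.γ j j) (fun τ => M.phiBar τ j) τ := fun τ => by
    simp only [phi_eq, Finset.sum_add_distrib]
  simp only [← h5]
  unfold output treeSeries
  simp only [mul_sub, sub_smul, Finset.sum_sub_distrib]
  abel

end Method

end LIRKW

theorem theorem1 (s p : ℕ) (M : LIRKW.Method s) :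
    M.HasOrder p ↔
      (∀ τ : LIRKW.LWTree, τ.IsButcher → τ.order ≤ p →
        ∑ j, M.phi τ j = 1 / (τ.density : ℝ)) ∧
      (∀ τ : LIRKW.LWTree, ¬ τ.IsButcher → τ.order ≤ p → ∑ j, M.phi τ j = 0) := by
  rw [M.order_conditions_iff]
  exact ⟨fun h τ hτ => h.sum_phi_eq hτ, M.hasOrder_of_sum_phi_eq⟩
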